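/- Let $(\mathcal A,\mathcal H,D)$ be an arbitrary spectral triple: $\mathcal H$ is a separable complex Hilbert space, $\mathcal A\subset\mathcal B(\mathcal H)$ is a (not necessarily unital, not necessarily commutative) $*$-subalgebra, and $D$ is a self-adjoint operator on $\mathcal H$ such that, for every $a\in\mathcal A$, the commutator $[D,a]$ is bounded (that is, $a$ preserves $\mathrm{Dom}\,D$ and $[D,a]$ extends to a bounded operator) and $a(D+i)^{-1}$ is compact. Let $\Lambda\in\mathbb R$, let $P_\Lambda=\mathbf 1_{[-\Lambda,\Lambda]}(D)$ be the spectral projection of $D$ on $[-\Lambda,\Lambda]$, and put $D_\Lambda=P_\Lambda DP_\Lambda$ and $\pi_\Lambda(a)=P_\Lambda aP_\Lambda$. Let $\mathcal A^{\mathrm{sa}}$ be the real space of self-adjoint elements of $\mathcal A$, let $\mathcal A^{\mathrm{sa}}_+=\mathcal A^{\mathrm{sa}}+\mathbb R1$ (which is $\mathcal A^{\mathrm{sa}}$ if $1\in\mathcal A$), with order unit $1$, and let $\mathcal O_\Lambda=\pi_\Lambda(\mathcal A^{\mathrm{sa}}_+)$, with order unit $P_\Lambda$. A state of such a space is a real-linear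 functional that is nonnegative on positive operators and equals $1$ at the order unit. For a state $\varphi$ of $\mathcal O_\Lambda$ let $\varphi^\sharp=\varphi\circ\pi_\Lambda$, a state of $\mathcal A^{\mathrm{sa}}_+$. For $T\in\{D,D_\Lambda\}$ define the $[0,\infty]$-valued distances $$d_{\mathcal A,T}(\varphi,\varphi')=\sup\{\varphi(a)-\varphi'(a): a\in\mathcal A^{\mathrm{sa}},\ \|[T,a]\|\le1\},\qquad d^\flat_{\mathcal A,D}(\varphi,\varphi')=d_{\mathcal A,D}(\varphi^\sharp,\varphi'^\sharp),$$ $$d_{\mathcal O_\Lambda,D_\Lambda}(\varphi,\varphi')=\sup\{\varphi(b)-\varphi'(b): b\in\mathcal O_\Lambda,\ \|[D_\Lambda,b]\|\le1\}.$$ Let $\psi$ be a unit vector in the range of $P_\Lambda$, and for $t\in\mathbb R$ let $\psi_t=e^{itD}\psi$ and $\Psi_t(b)=\langle\psi_t,b\,\psi_t\rangle$. Then, for every $t$, $\Psi_t$ is a state of $\mathcal O_\Lambda$, and $\Psi_t^\sharp$ is a state of $\mathcal A^{\mathrm{sa}}_+$, given by $\Psi_t^\sharp(a)=\langle\psi_t,a\,\psi_t\rangle$.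 Moreover, for all $t_1,t_2\in\mathbb R$, $$d_{\mathcal A,D_\Lambda}(\Psi_{t_1}^\sharp,\Psi_{t_2}^\sharp)\le|t_1-t_2|,$$ $$d^\flat_{\mathcal A,D}(\Psi_{t_1},\Psi_{t_2})\le d_{\mathcal O_\Lambda,D_\Lambda}(\Psi_{t_1},\Psi_{t_2})\le|t_1-t_2|,$$ so that all these distances are finite on the orbit. -/

import Mathlib

open scoped InnerProductSpace NNReal ENNReal

namespace SpectralTruncation

noncomputable section

variable {H : Type*} [NormedAddCommGroup H] [InnerProductSpace ℂ H] [CompleteSpace H]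

/-! ## Spectral measures, spectral projections and the unitary group of a self-adjoint operator -/

/-- A projection-valued measure on the Borel sets of `ℝ`, countably additive in the strong
operator topology. Only the values on measurable sets are meaningful. -/
structure ProjectionValuedMeasure (H : Type*) [NormedAddCommGroup H] [InnerProductSpace ℂ H]
    [CompleteSpace H] where
  /-- the projection attached to a set -/
  proj : Set ℝ → H →L[ℂ] H
  isStarProjection : ∀ S, MeasurableSet S → IsStarProjection (proj S)
  empty : proj ∅ = 0
  univ : proj Set.univ = 1
  inter : ∀ S T, MeasurableSet S → MeasurableSet T → proj (S ∩ T) = proj S * proj T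
  hasSum_iUnion : ∀ S : ℕ → Set ℝ, (∀ n, MeasurableSet (S n)) →
    Pairwise (Function.onFun Disjoint S) → ∀ x : H,
      HasSum (fun n => proj (S n) x) (proj (⋃ n, S n) x)

namespace ProjectionValuedMeasure

variable (E : ProjectionValuedMeasure H)

lemma re_inner_nonneg {S : Set ℝ} (hS : MeasurableSet S) (x : H) :
    0 ≤ (⟪x, E.proj S x⟫_ℂ).re :=
  ((ContinuousLinearMap.nonneg_iff_isPositive _).1
    (E.isStarProjection S hS).nonneg).re_inner_nonneg_right x

/-- The scalar measure `S ↦ ⟨x, E(S) x⟩`. -/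
def scalarMeasure (x : H) : MeasureTheory.Measure ℝ :=
  MeasureTheory.Measure.ofMeasurable
    (fun S _ => ENNReal.ofReal (⟪x, E.proj S x⟫_ℂ).re)
    (by simp [E.empty])
    (by
      intro S hS hd
      have h1 : HasSum (fun n => (⟪x, E.proj (S n) x⟫_ℂ).re) (⟪x, E.proj (⋃ n, S n) x⟫_ℂ).re :=
        ((E.hasSum_iUnion S hS hd x).mapL (innerSL ℂ x)).mapL Complex.reCLM
      rw [← h1.tsum_eq]
      exact ENNReal.ofReal_tsum_of_nonneg (fun n => E.re_inner_nonneg (hS n) x) h1.summable)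

/-- `T = ∫ f dE`, for a bounded Borel function `f`: the operator `T` is determined by
`⟨x, T x⟩ = ∫ f d⟨x, E x⟩` for all `x`. -/
def IsIntegral (f : ℝ → ℂ) (T : H →L[ℂ] H) : Prop :=
  ∀ x : H, ⟪x, T x⟫_ℂ = ∫ l, f l ∂(E.scalarMeasure x)

open Classical in
/-- The bounded operator `∫ f dE`, for a bounded Borel function `f`. -/
def integral (f : ℝ → ℂ) : H →L[ℂ] H :=
  if h : ∃ T : H →L[ℂ] H, E.IsIntegral f T then h.choose else 0

end ProjectionValuedMeasure

/-- `D = ∫ l dE(l)`: the domain of `D` consists of the `x` for which `∫ l² d⟨x, E(l) x⟩` is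
finite, and `⟨x, D x⟩ = ∫ l d⟨x, E(l) x⟩` on this domain. -/
def IsSpectralMeasure (D : H →ₗ.[ℂ] H) (E : ProjectionValuedMeasure H) : Prop :=
  (∀ x : H, x ∈ D.domain ↔ ∫⁻ l, ENNReal.ofReal (l ^ 2) ∂(E.scalarMeasure x) < ∞) ∧
  ∀ x : D.domain, ⟪(x : H), D x⟫_ℂ = ∫ l, (l : ℂ) ∂(E.scalarMeasure (x : H))

open Classical in
/-- The spectral projection `1_S(D)` of a self-adjoint operator `D`, that is `E(S)` for the
spectral measure `E` of `D` (which exists and is unique on Borel sets, by the spectral theorem). -/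
def spectralProjection (D : H →ₗ.[ℂ] H) (S : Set ℝ) : H →L[ℂ] H :=
  if h : ∃ E : ProjectionValuedMeasure H, IsSpectralMeasure D E then h.choose.proj S else 0

open Classical in
/-- The unitary group `e^{itD} = ∫ e^{itl} dE(l)` of a self-adjoint operator `D`, where `E` is
the spectral measure of `D`. -/
def unitaryGroup (D : H →ₗ.[ℂ] H) (t : ℝ) : H →L[ℂ] H :=
  if h : ∃ E : ProjectionValuedMeasure H, IsSpectralMeasure D E then
    h.choose.integral (fun l => Complex.exp (Complex.I * t * l))
  else 0

/-! ## Lipschitz seminorms and spectral distances -/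

/-- `‖[T, a]‖` for a densely defined operator `T` and a bounded operator `a`: the least `C` such
that `a` preserves the domain of `T` and `‖(T a - a T) x‖ ≤ C ‖x‖` on that domain, and `∞` when
there is no such `C`. -/
def lipSeminorm (T : H →ₗ.[ℂ] H) (a : H →L[ℂ] H) : ℝ≥0∞ :=
  ⨅ (C : ℝ≥0) (_ : ∃ h : ∀ x : T.domain, a (x : H) ∈ T.domain,
    ∀ x : T.domain, ‖T ⟨a x, h x⟩ - a (T x)‖ ≤ C * ‖(x : H)‖), (C : ℝ≥0∞)

/-- The distance `sup {φ a - χ a : a ∈ V, ‖[T, a]‖ ≤ 1}` on linear functionals of a real subspace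
`V` of `B(H)`. As `0 ∈ V`, the supremum is nonnegative, so that it may be taken in `[0, ∞]`. -/
def lipDist (V : Submodule ℝ (H →L[ℂ] H)) (T : H →ₗ.[ℂ] H) (φ χ : V →ₗ[ℝ] ℝ) : ℝ≥0∞ :=
  ⨆ (a : V) (_ : lipSeminorm T (a : H →L[ℂ] H) ≤ 1), ENNReal.ofReal (φ a - χ a)

/-- A state of a real space `V` of self-adjoint operators with order unit `e`: a positive linear
functional with value `1` at `e`. -/
def IsState (V : Submodule ℝ (H →L[ℂ] H)) (e : V) (φ : V →ₗ[ℝ] ℝ) : Prop :=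
  (∀ a : V, 0 ≤ (a : H →L[ℂ] H) → 0 ≤ φ a) ∧ φ e = 1

/-- The functional `a ↦ ⟨ψ, a ψ⟩` on a real space `V` of self-adjoint operators (on which it is
real-valued). -/
def vectorFunctional (V : Submodule ℝ (H →L[ℂ] H)) (ψ : H) : V →ₗ[ℝ] ℝ where
  toFun a := (⟪ψ, (a : H →L[ℂ] H) ψ⟫_ℂ).re
  map_add' a b := by simp
  map_smul' r a := by simp [inner_smul_right_eq_smul]

/-- The compression `a ↦ P a P`. -/
def compression (P : H →L[ℂ] H) : (H →L[ℂ] H) →ₗ[ℝ] (H →L[ℂ] H) where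
  toFun a := P * a * P
  map_add' a b := by rw [mul_add, add_mul]
  map_smul' r a := by simp

/-- The operator `P D P`, with domain `{x : P x ∈ Dom D}`. -/
def truncatedOperator (D : H →ₗ.[ℂ] H) (P : H →L[ℂ] H) : H →ₗ.[ℂ] H where
  domain := D.domain.comap (P : H →ₗ[ℂ] H)
  toFun := (P : H →ₗ[ℂ] H) ∘ₗ D.toFun ∘ₗ
    ((P : H →ₗ[ℂ] H).restrict (p := D.domain.comap (P : H →ₗ[ℂ] H)) (q := D.domain)
      fun _ hx => hx)

/-! ## Spectral triples and their truncations -/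

/-- A spectral triple `(A, H, D)`; `A` need not be unital. -/
structure SpectralTriple (H : Type*) [NormedAddCommGroup H] [InnerProductSpace ℂ H]
    [CompleteSpace H] [TopologicalSpace.SeparableSpace H] where
  /-- the `*`-algebra -/
  A : NonUnitalStarSubalgebra ℂ (H →L[ℂ] H)
  /-- the Dirac operator -/
  D : H →ₗ.[ℂ] H
  dense_domain : Dense (D.domain : Set H)
  isSelfAdjoint : IsSelfAdjoint D
  /-- `[D, a]` is bounded -/
  lipSeminorm_lt_top : ∀ a ∈ A, lipSeminorm D a < ∞
  /-- `a (D + i)⁻¹` is compact: it is the operator `K` with `K (D + i) = a` -/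
  compact_resolvent : ∀ a ∈ A, ∃ K : H →L[ℂ] H, IsCompactOperator K ∧
    ∀ x : D.domain, K (D x + Complex.I • (x : H)) = a x

namespace SpectralTriple

variable [TopologicalSpace.SeparableSpace H] (X : SpectralTriple H)

/-- The real space `A^sa` of self-adjoint elements of `A`. -/
def sa : Submodule ℝ (H →L[ℂ] H) :=
  X.A.toSubmodule.restrictScalars ℝ ⊓ selfAdjoint.submodule ℝ (H →L[ℂ] H)

/-- The real space `A^sa + ℝ 1` of self-adjoint elements of the unitization of `A`. It is `A^sa`
when `1 ∈ A`. -/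
def unitizedSa : Submodule ℝ (H →L[ℂ] H) := X.sa ⊔ Submodule.span ℝ {1}

/-- The order unit `1` of `A^sa + ℝ 1`. -/
def one : X.unitizedSa :=
  ⟨1, Submodule.mem_sup_right (Submodule.mem_span_singleton_self 1)⟩

/-- The spectral distance `d_{A,T}`, on functionals of `A^sa + ℝ 1`: the supremum runs over the
self-adjoint elements of `A`. -/
def dist (T : H →ₗ.[ℂ] H) (φ χ : X.unitizedSa →ₗ[ℝ] ℝ) : ℝ≥0∞ :=
  lipDist X.sa T (φ ∘ₗ Submodule.inclusion le_sup_left) (χ ∘ₗ Submodule.inclusion le_sup_left)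

/-- The spectral projection `P_Λ` of `D` on `[-Λ, Λ]`. -/
def P (Λ : ℝ) : H →L[ℂ] H := spectralProjection X.D (Set.Icc (-Λ) Λ)

/-- The truncated Dirac operator `D_Λ = P_Λ D P_Λ`. -/
def truncD (Λ : ℝ) : H →ₗ.[ℂ] H := truncatedOperator X.D (X.P Λ)

/-- The order unit space `O_Λ = P_Λ A^sa P_Λ` (with `A` replaced by its unitization if `1 ∉ A`). -/
def O (Λ : ℝ) : Submodule ℝ (H →L[ℂ] H) := X.unitizedSa.map (compression (X.P Λ))

/-- The map `π_Λ : a ↦ P_Λ a P_Λ`, from `A^sa + ℝ 1` to `O_Λ`. -/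
def π (Λ : ℝ) : X.unitizedSa →ₗ[ℝ] X.O Λ :=
  (compression (X.P Λ)).restrict fun _ ha => Submodule.mem_map_of_mem ha

/-- The order unit `P_Λ = π_Λ(1)` of `O_Λ`. -/
def orderUnit (Λ : ℝ) : X.O Λ := X.π Λ X.one

/-- `φ^♯ = φ ∘ π_Λ`. -/
def sharp (Λ : ℝ) (φ : X.O Λ →ₗ[ℝ] ℝ) : X.unitizedSa →ₗ[ℝ] ℝ := φ ∘ₗ X.π Λ

/-- The distance `d^♭_{A,D}(φ, χ) = d_{A,D}(φ^♯, χ^♯)` on functionals of `O_Λ`. -/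
def distFlat (Λ : ℝ) (φ χ : X.O Λ →ₗ[ℝ] ℝ) : ℝ≥0∞ :=
  X.dist X.D (X.sharp Λ φ) (X.sharp Λ χ)

/-- The distance `d_{O_Λ,D_Λ}`, on functionals of `O_Λ`. -/
def distTrunc (Λ : ℝ) (φ χ : X.O Λ →ₗ[ℝ] ℝ) : ℝ≥0∞ := lipDist (X.O Λ) (X.truncD Λ) φ χ

/-- The orbit `Ψ_t = ⟨ψ_t, · ψ_t⟩`, `ψ_t = e^{itD} ψ`, of the vector state of `ψ` under the
geodesic flow, as a functional on `O_Λ`. -/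
def orbit (Λ : ℝ) (ψ : H) (t : ℝ) : X.O Λ →ₗ[ℝ] ℝ :=
  vectorFunctional (X.O Λ) (unitaryGroup X.D t ψ)

end SpectralTriple

end

end SpectralTruncation

/-!
Let `E` be the spectral measure of `D` through which `P = E([-Λ, Λ])` and `e^{itD}` are defined;
there is one, since the range of `P` contains a unit vector and so `P ≠ 0`.

The relation `E.IsIntegral f T` is a bounded Borel functional calculus: `∫ f dE` exists for bounded
Borel `f` (uniform limits of simple functions, `isIntegral_integral`), is unique because a complex
quadratic form determines its operator (`IsIntegral.unique`), is multiplicative (`IsIntegral.mul`),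
and has norm at most `sup |f|` (`IsIntegral.norm_le`).

It follows that `D` restricted to the range of `P` is the bounded self-adjoint operator
`T = ∫ l 1_{[-Λ, Λ]}(l) dE(l)` (`IsSpectralMeasure.apply_proj`), and, as `D` is symmetric, that
`P D = T` on the domain of `D` (`IsSpectralMeasure.proj_apply`). Hence `P D P` is everywhere defined
and equal to `T`, and `[P D P, P a P] = P [D, a] P`. So `a ↦ P a P` maps the unit ball of
`‖[D, ·]‖` to that of `‖[D_Λ, ·]‖` (`IsSpectralMeasure.lipSeminorm_compression_le`), which compares
`d^♭` with the distance of `O_Λ`.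

For `ψ` in the range of `P` the vectors `ψ_t = e^{itD} ψ` stay in this range and have the norm of
`ψ`, which gives the assertions on states. Moreover `ψ_t` is differentiable with derivative
`i T ψ_t` (`hasDerivAt_exp_apply`), so that `⟨ψ_t, a ψ_t⟩` has derivative `-i ⟨ψ_t, [T, a] ψ_t⟩`,
of modulus at most `‖[T, a]‖`. The mean value inequality
(`IsSpectralMeasure.re_inner_orbit_sub_le`) bounds both distances for `D_Λ` by `|t₁ - t₂|`; it
applies to every bounded `a`, whether taken from `A` or from `O_Λ`.
-/

namespace SpectralTruncation

open MeasureTheory Filter Topology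

variable {H : Type*} [NormedAddCommGroup H] [InnerProductSpace ℂ H] [CompleteSpace H]

namespace ProjectionValuedMeasure

variable (E : ProjectionValuedMeasure H)

/-! ### The scalar measures of a projection-valued measure -/

lemma inner_proj_right {S : Set ℝ} (hS : MeasurableSet S) (x y : H) :
    ⟪x, E.proj S y⟫_ℂ = ⟪E.proj S x, y⟫_ℂ := by
  rw [← ContinuousLinearMap.adjoint_inner_left,
    ((E.isStarProjection S hS).isSelfAdjoint).adjoint_eq]

lemma proj_proj {S T : Set ℝ} (hS : MeasurableSet S) (hT : MeasurableSet T) (x : H) :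
    E.proj S (E.proj T x) = E.proj (S ∩ T) x := by
  rw [E.inter S T hS hT]; rfl

lemma inner_proj_self {S : Set ℝ} (hS : MeasurableSet S) (x : H) :
    ⟪x, E.proj S x⟫_ℂ = ((‖E.proj S x‖ ^ 2 : ℝ) : ℂ) := by
  have h := E.proj_proj hS hS x
  rw [Set.inter_self] at h
  rw [← h, E.inner_proj_right hS, h, inner_self_eq_norm_sq_to_K]
  simp

lemma scalarMeasure_apply {S : Set ℝ} (hS : MeasurableSet S) (x : H) :
    E.scalarMeasure x S = ENNReal.ofReal (‖E.proj S x‖ ^ 2) := by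
  rw [scalarMeasure, Measure.ofMeasurable_apply S hS, E.inner_proj_self hS, Complex.ofReal_re]

lemma scalarMeasure_univ (x : H) :
    E.scalarMeasure x Set.univ = ENNReal.ofReal (‖x‖ ^ 2) := by
  rw [E.scalarMeasure_apply MeasurableSet.univ, E.univ, one_apply_eq_self]

instance isFiniteMeasure_scalarMeasure (x : H) : IsFiniteMeasure (E.scalarMeasure x) :=
  ⟨by rw [E.scalarMeasure_univ]; exact ENNReal.ofReal_lt_top⟩

lemma scalarMeasure_real {S : Set ℝ} (hS : MeasurableSet S) (x : H) :
    ((E.scalarMeasure x).real S : ℂ) = ⟪x, E.proj S x⟫_ℂ := by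
  rw [Measure.real, E.scalarMeasure_apply hS, ENNReal.toReal_ofReal (sq_nonneg _),
    E.inner_proj_self hS]

lemma scalarMeasure_real_univ (x : H) : (E.scalarMeasure x).real Set.univ = ‖x‖ ^ 2 := by
  rw [Measure.real, E.scalarMeasure_univ, ENNReal.toReal_ofReal (sq_nonneg _)]

lemma scalarMeasure_proj {S : Set ℝ} (hS : MeasurableSet S) (x : H) :
    E.scalarMeasure (E.proj S x) = (E.scalarMeasure x).restrict S := by
  ext T hT
  rw [Measure.restrict_apply hT, E.scalarMeasure_apply hT, E.scalarMeasure_apply (hT.inter hS),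
    E.proj_proj hT hS]

/-! ### The bounded Borel functional calculus -/

variable {E}

lemma integrable_of_bounded {f : ℝ → ℂ} (hf : Measurable f) {C : ℝ} (hC : ∀ l, ‖f l‖ ≤ C)
    (x : H) : Integrable f (E.scalarMeasure x) :=
  Integrable.of_bound hf.aestronglyMeasurable C (ae_of_all _ hC)

lemma integrable_simpleFunc (g : SimpleFunc ℝ ℂ) (x : H) : Integrable g (E.scalarMeasure x) :=
  g.integrable_of_isFiniteMeasure

/-- The quadratic form `x ↦ ⟨x, T x⟩` determines `T`, so `∫ f dE` is unique. -/
lemma IsIntegral.unique {f : ℝ → ℂ} {S T : H →L[ℂ] H} (hS : E.IsIntegral f S)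
    (hT : E.IsIntegral f T) : S = T := by
  refine ContinuousLinearMap.coe_injective ((ext_inner_map _ _).1 fun x => ?_)
  have h := congrArg (starRingEnd ℂ) ((hS x).trans (hT x).symm)
  rwa [inner_conj_symm, inner_conj_symm] at h

lemma IsIntegral.add {f g : ℝ → ℂ} {S T : H →L[ℂ] H} (hS : E.IsIntegral f S)
    (hT : E.IsIntegral g T) (hf : ∀ x, Integrable f (E.scalarMeasure x))
    (hg : ∀ x, Integrable g (E.scalarMeasure x)) :
    E.IsIntegral (fun l => f l + g l) (S + T) := fun x => by
  rw [integral_add (hf x) (hg x), ← hS x, ← hT x, add_apply, inner_add_right]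

lemma IsIntegral.const_smul {f : ℝ → ℂ} {T : H →L[ℂ] H} (hT : E.IsIntegral f T) (c : ℂ) :
    E.IsIntegral (fun l => c * f l) (c • T) := fun x => by
  rw [integral_const_mul, ← hT x, smul_apply, inner_smul_right]

lemma IsIntegral.sub {f g : ℝ → ℂ} {S T : H →L[ℂ] H} (hS : E.IsIntegral f S)
    (hT : E.IsIntegral g T) (hf : ∀ x, Integrable f (E.scalarMeasure x))
    (hg : ∀ x, Integrable g (E.scalarMeasure x)) :
    E.IsIntegral (fun l => f l - g l) (S - T) := fun x => by
  rw [integral_sub (hf x) (hg x), ← hS x, ← hT x, sub_apply, inner_sub_right]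

lemma IsIntegral.adjoint {f : ℝ → ℂ} {T : H →L[ℂ] H} (hT : E.IsIntegral f T) :
    E.IsIntegral (fun l => starRingEnd ℂ (f l)) (ContinuousLinearMap.adjoint T) := fun x => by
  rw [integral_conj, ← hT x, ContinuousLinearMap.adjoint_inner_right, inner_conj_symm]

lemma isIntegral_indicator {S : Set ℝ} (hS : MeasurableSet S) (c : ℂ) :
    E.IsIntegral (S.indicator fun _ => c) (c • E.proj S) := fun x => by
  rw [integral_indicator_const c hS, smul_apply, inner_smul_right,
    ← E.scalarMeasure_real hS, mul_comm]
  simp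

lemma isIntegral_one : E.IsIntegral (fun _ => 1) 1 := by
  have h := isIntegral_indicator (E := E) MeasurableSet.univ 1
  rwa [Set.indicator_univ, E.univ, one_smul] at h

lemma coe_piecewise_const_zero {S : Set ℝ} (hS : MeasurableSet S) (c : ℂ) :
    ⇑(SimpleFunc.piecewise S hS (SimpleFunc.const ℝ c) (SimpleFunc.const ℝ 0)) =
      S.indicator fun _ => c := by
  classical
  ext l
  by_cases h : l ∈ S <;> simp [h]

lemma exists_isIntegral_simpleFunc (g : SimpleFunc ℝ ℂ) : ∃ T, E.IsIntegral g T := by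
  induction g using SimpleFunc.induction with
  | const c hS =>
    rw [coe_piecewise_const_zero]
    exact ⟨_, isIntegral_indicator hS c⟩
  | add _ ih₁ ih₂ =>
    obtain ⟨S, hS⟩ := ih₁
    obtain ⟨T, hT⟩ := ih₂
    exact ⟨_, hS.add hT (integrable_simpleFunc _) (integrable_simpleFunc _)⟩

/-- Multiplicativity for simple functions; it comes down to `E(S) E(T) = E(S ∩ T)`. -/
lemma IsIntegral.mul_simpleFunc {f g : SimpleFunc ℝ ℂ} {S T : H →L[ℂ] H}
    (hS : E.IsIntegral f S) (hT : E.IsIntegral g T) :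
    E.IsIntegral (fun l => f l * g l) (S * T) := by
  induction f using SimpleFunc.induction generalizing S with
  | @const c A hA =>
    rw [coe_piecewise_const_zero] at hS ⊢
    obtain rfl := hS.unique (isIntegral_indicator hA c)
    induction g using SimpleFunc.induction generalizing T with
    | @const d B hB =>
      rw [coe_piecewise_const_zero] at hT ⊢
      obtain rfl := hT.unique (isIntegral_indicator hB d)
      have h := isIntegral_indicator (E := E) (hA.inter hB) (c * d)
      rw [smul_mul_smul_comm, ← E.inter A B hA hB]
      convert h using 2 with l
      exact (Set.inter_indicator_mul (fun _ => c) (fun _ => d) l).symm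
    | @add g₁ g₂ _ ih₁ ih₂ =>
      obtain ⟨T₁, h₁⟩ := exists_isIntegral_simpleFunc (E := E) g₁
      obtain ⟨T₂, h₂⟩ := exists_isIntegral_simpleFunc (E := E) g₂
      obtain rfl := hT.unique (h₁.add h₂ (integrable_simpleFunc _) (integrable_simpleFunc _))
      have h := (ih₁ h₁).add (ih₂ h₂)
        (fun x => by
          rw [← coe_piecewise_const_zero hA]; exact integrable_simpleFunc (_ * g₁) x)
        (fun x => by
          rw [← coe_piecewise_const_zero hA]; exact integrable_simpleFunc (_ * g₂) x)
      simpa only [SimpleFunc.coe_add, Pi.add_apply, mul_add] using h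
  | @add f₁ f₂ _ ih₁ ih₂ =>
    obtain ⟨S₁, h₁⟩ := exists_isIntegral_simpleFunc (E := E) f₁
    obtain ⟨S₂, h₂⟩ := exists_isIntegral_simpleFunc (E := E) f₂
    obtain rfl := hS.unique (h₁.add h₂ (integrable_simpleFunc _) (integrable_simpleFunc _))
    have h := (ih₁ h₁).add (ih₂ h₂) (integrable_simpleFunc (f₁ * g)) (integrable_simpleFunc (f₂ * g))
    simpa only [SimpleFunc.coe_add, Pi.add_apply, add_mul] using h

/-- If `T† T` is the integral of `|f|²`, then `T` is bounded by any bound of `f`. -/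
lemma norm_le_of_isIntegral_adjoint_mul {f : ℝ → ℂ} {T : H →L[ℂ] H} {C : ℝ} (hC : ∀ l, ‖f l‖ ≤ C)
    (h : E.IsIntegral (fun l => starRingEnd ℂ (f l) * f l) (ContinuousLinearMap.adjoint T * T)) :
    ‖T‖ ≤ C := by
  have hC₀ : 0 ≤ C := (norm_nonneg _).trans (hC 0)
  refine T.opNorm_le_bound hC₀ fun x => ?_
  have h₁ : ‖T x‖ ^ 2 = ‖∫ l, starRingEnd ℂ (f l) * f l ∂(E.scalarMeasure x)‖ := by
    rw [← h x, mul_apply_eq_comp, ContinuousLinearMap.adjoint_inner_right,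
      inner_self_eq_norm_sq_to_K]
    simp
  have h₂ : ‖∫ l, starRingEnd ℂ (f l) * f l ∂(E.scalarMeasure x)‖ ≤ C ^ 2 * ‖x‖ ^ 2 := by
    rw [← E.scalarMeasure_real_univ]
    refine norm_integral_le_of_norm_le_const (ae_of_all _ fun l => ?_)
    rw [norm_mul, RCLike.norm_conj, sq]
    exact mul_self_le_mul_self (norm_nonneg _) (hC l)
  rw [← h₁, ← mul_pow] at h₂
  exact (sq_le_sq₀ (norm_nonneg _) (by positivity)).1 h₂

lemma IsIntegral.norm_le_simpleFunc {f : SimpleFunc ℝ ℂ} {T : H →L[ℂ] H} (hT : E.IsIntegral f T)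
    {C : ℝ} (hC : ∀ l, ‖f l‖ ≤ C) : ‖T‖ ≤ C :=
  norm_le_of_isIntegral_adjoint_mul hC
    (IsIntegral.mul_simpleFunc (f := f.map (starRingEnd ℂ)) hT.adjoint hT)

/-- A bounded Borel function is a uniform limit of simple functions, because a ball of `ℂ` is
totally bounded. -/
lemma exists_simpleFunc_near {f : ℝ → ℂ} (hf : Measurable f) {C : ℝ} (hC : ∀ l, ‖f l‖ ≤ C)
    {ε : ℝ} (hε : 0 < ε) : ∃ g : SimpleFunc ℝ ℂ, ∀ l, ‖f l - g l‖ ≤ ε := by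
  obtain ⟨t, ht⟩ := (isCompact_closedBall (0 : ℂ) C).elim_finite_subcover
    (fun n => Metric.ball (TopologicalSpace.denseSeq ℂ n) ε) (fun _ => Metric.isOpen_ball)
    (fun z _ => by
      obtain ⟨n, hn⟩ := (TopologicalSpace.denseRange_denseSeq ℂ).exists_dist_lt z hε
      exact Set.mem_iUnion.2 ⟨n, hn⟩)
  refine ⟨(SimpleFunc.nearestPt (TopologicalSpace.denseSeq ℂ) (t.sup id)).comp f hf, fun l => ?_⟩
  obtain ⟨n, hn, hl⟩ := Set.mem_iUnion₂.1 (ht (mem_closedBall_zero_iff.2 (hC l)))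
  have h := SimpleFunc.edist_nearestPt_le (TopologicalSpace.denseSeq ℂ) (f l)
    (Finset.le_sup (f := id) hn)
  rw [edist_dist, edist_dist, ENNReal.ofReal_le_ofReal_iff dist_nonneg] at h
  rw [← dist_eq_norm, dist_comm]
  rw [Metric.mem_ball, dist_comm] at hl
  exact h.trans hl.le

/-- Integrals of bounded Borel functions are norm limits of integrals of simple functions that
converge uniformly. -/
lemma exists_isIntegral_tendsto {f : ℝ → ℂ} (hf : Measurable f) {C : ℝ} (hC : ∀ l, ‖f l‖ ≤ C) :
    ∃ (g : ℕ → SimpleFunc ℝ ℂ) (S : ℕ → H →L[ℂ] H) (T : H →L[ℂ] H),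
      (∀ n l, ‖g n l‖ ≤ C + 1) ∧ (∀ l, Tendsto (fun n => g n l) atTop (𝓝 (f l))) ∧
      (∀ n, E.IsIntegral (g n) (S n)) ∧ Tendsto S atTop (𝓝 T) ∧ E.IsIntegral f T := by
  have hpos : ∀ n : ℕ, (0 : ℝ) < 1 / (n + 1) := fun n => by positivity
  choose g hg using fun n : ℕ => exists_simpleFunc_near hf hC (hpos n)
  choose S hS using fun n => exists_isIntegral_simpleFunc (E := E) (g n)
  have hgC : ∀ n l, ‖g n l‖ ≤ C + 1 := fun n l => by
    have h1 : (1 : ℝ) / (n + 1) ≤ 1 := by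
      rw [div_le_one (by positivity)]; linarith [(Nat.cast_nonneg n : (0 : ℝ) ≤ n)]
    have h2 : g n l = f l - (f l - g n l) := by ring
    rw [h2]
    exact (norm_sub_le _ _).trans (add_le_add (hC l) ((hg n l).trans h1))
  have hglim : ∀ l, Tendsto (fun n => g n l) atTop (𝓝 (f l)) := fun l => by
    rw [tendsto_iff_norm_sub_tendsto_zero]
    refine squeeze_zero (fun _ => norm_nonneg _) (fun n => ?_) tendsto_one_div_add_atTop_nhds_zero_nat
    rw [norm_sub_rev]; exact hg n l
  have hcauchy : CauchySeq S := by
    refine cauchySeq_of_le_tendsto_0 (fun n : ℕ => 2 * (1 / ((n : ℝ) + 1))) (fun n m N hn hm => ?_)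
      (by simpa using tendsto_one_div_add_atTop_nhds_zero_nat.const_mul (2 : ℝ))
    rw [dist_eq_norm]
    have h := (hS n).sub (hS m) (integrable_simpleFunc _) (integrable_simpleFunc _)
    refine IsIntegral.norm_le_simpleFunc (f := g n - g m) h fun l => ?_
    have h2 : (g n - g m) l = (f l - g m l) - (f l - g n l) := by
      rw [SimpleFunc.sub_apply]; ring
    rw [h2, two_mul]
    exact (norm_sub_le _ _).trans (add_le_add
      ((hg m l).trans (one_div_le_one_div_of_le (by positivity) (by gcongr)))
      ((hg n l).trans (one_div_le_one_div_of_le (by positivity) (by gcongr))))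
  obtain ⟨T, hT⟩ := cauchySeq_tendsto_of_complete hcauchy
  refine ⟨g, S, T, hgC, hglim, hS, hT, fun x => ?_⟩
  have h₁ : Tendsto (fun n => ⟪x, S n x⟫_ℂ) atTop (𝓝 ⟪x, T x⟫_ℂ) :=
    tendsto_const_nhds.inner ((ContinuousLinearMap.apply ℂ H x).continuous.tendsto T |>.comp hT)
  refine tendsto_nhds_unique h₁ ?_
  simp_rw [fun n => hS n x]
  exact tendsto_integral_of_dominated_convergence (fun _ => C + 1)
    (fun n => (g n).aestronglyMeasurable) (integrable_const _)
    (fun n => ae_of_all _ (hgC n)) (ae_of_all _ hglim)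

/-- The operator `∫ f dE` exists for every bounded Borel function `f`. -/
lemma isIntegral_integral {f : ℝ → ℂ} (hf : Measurable f) {C : ℝ} (hC : ∀ l, ‖f l‖ ≤ C) :
    E.IsIntegral f (E.integral f) := by
  have h : ∃ T, E.IsIntegral f T := by
    obtain ⟨-, -, T, -, -, -, -, hT⟩ := exists_isIntegral_tendsto (E := E) hf hC
    exact ⟨T, hT⟩
  rw [integral, dif_pos h]
  exact h.choose_spec

lemma IsIntegral.mul {f g : ℝ → ℂ} {S T : H →L[ℂ] H} (hS : E.IsIntegral f S)
    (hT : E.IsIntegral g T) (hf : Measurable f) (hg : Measurable g) {C K : ℝ}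
    (hC : ∀ l, ‖f l‖ ≤ C) (hK : ∀ l, ‖g l‖ ≤ K) :
    E.IsIntegral (fun l => f l * g l) (S * T) := by
  obtain ⟨f', S', S₀, hf', hf'lim, hS', hS'lim, hS₀⟩ := exists_isIntegral_tendsto (E := E) hf hC
  obtain ⟨g', T', T₀, hg', hg'lim, hT', hT'lim, hT₀⟩ := exists_isIntegral_tendsto (E := E) hg hK
  obtain rfl := hS.unique hS₀
  obtain rfl := hT.unique hT₀
  intro x
  have h₁ : Tendsto (fun n => ⟪x, (S' n * T' n) x⟫_ℂ) atTop (𝓝 ⟪x, (S * T) x⟫_ℂ) :=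
    tendsto_const_nhds.inner
      ((ContinuousLinearMap.apply ℂ H x).continuous.tendsto (S * T) |>.comp (hS'lim.mul hT'lim))
  refine tendsto_nhds_unique h₁ ?_
  simp_rw [fun n => (hS' n).mul_simpleFunc (hT' n) x]
  refine tendsto_integral_of_dominated_convergence (fun _ => (C + 1) * (K + 1))
    (fun n => (f' n * g' n).aestronglyMeasurable) (integrable_const _)
    (fun n => ae_of_all _ fun l => ?_) (ae_of_all _ fun l => (hf'lim l).mul (hg'lim l))
  rw [norm_mul]
  exact mul_le_mul (hf' n l) (hg' n l) (norm_nonneg _) ((norm_nonneg _).trans (hf' n l))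

lemma IsIntegral.adjoint_mul_self {f : ℝ → ℂ} {T : H →L[ℂ] H} (hT : E.IsIntegral f T)
    (hf : Measurable f) {C : ℝ} (hC : ∀ l, ‖f l‖ ≤ C) :
    E.IsIntegral (fun l => starRingEnd ℂ (f l) * f l) (ContinuousLinearMap.adjoint T * T) :=
  hT.adjoint.mul hT (Complex.continuous_conj.measurable.comp hf) hf
    (fun l => (RCLike.norm_conj (f l)).trans_le (hC l)) hC

lemma IsIntegral.norm_le {f : ℝ → ℂ} {T : H →L[ℂ] H} (hT : E.IsIntegral f T)
    (hf : Measurable f) {C : ℝ} (hC : ∀ l, ‖f l‖ ≤ C) : ‖T‖ ≤ C :=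
  norm_le_of_isIntegral_adjoint_mul hC (hT.adjoint_mul_self hf hC)

lemma IsIntegral.adjoint_eq {f : ℝ → ℂ} {T : H →L[ℂ] H} (hT : E.IsIntegral f T)
    (hf : ∀ l, starRingEnd ℂ (f l) = f l) : ContinuousLinearMap.adjoint T = T :=
  IsIntegral.unique hT.adjoint (by simpa only [hf] using hT)

end ProjectionValuedMeasure

open ProjectionValuedMeasure

/-! ### The operator on a bounded spectral subspace -/

/-- The function `l ↦ l` cut off to `[-Λ, Λ]`. -/
noncomputable def cutoff (Λ : ℝ) : ℝ → ℂ := (Set.Icc (-Λ) Λ).indicator fun l => (l : ℂ)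

lemma measurable_cutoff (Λ : ℝ) : Measurable (cutoff Λ) :=
  Complex.measurable_ofReal.indicator measurableSet_Icc

lemma norm_cutoff_le (Λ l : ℝ) : ‖cutoff Λ l‖ ≤ |Λ| := by
  by_cases hl : l ∈ Set.Icc (-Λ) Λ
  · rw [cutoff, Set.indicator_of_mem hl, Complex.norm_real]
    exact (abs_le.2 hl).trans (le_abs_self Λ)
  · rw [cutoff, Set.indicator_of_notMem hl, norm_zero]
    exact abs_nonneg _

lemma conj_cutoff (Λ l : ℝ) : starRingEnd ℂ (cutoff Λ l) = cutoff Λ l := by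
  by_cases hl : l ∈ Set.Icc (-Λ) Λ <;> simp [cutoff, hl]

variable {E : ProjectionValuedMeasure H} {D : H →ₗ.[ℂ] H}

lemma isIntegral_proj {S : Set ℝ} (hS : MeasurableSet S) :
    E.IsIntegral (S.indicator fun _ => 1) (E.proj S) := by
  simpa only [one_smul] using isIntegral_indicator (E := E) hS 1

lemma norm_indicator_one_le (S : Set ℝ) (l : ℝ) : ‖S.indicator (fun _ => (1 : ℂ)) l‖ ≤ 1 := by
  simpa using norm_indicator_le_norm_self (s := S) (fun _ : ℝ => (1 : ℂ)) l

lemma measurable_indicator_one {S : Set ℝ} (hS : MeasurableSet S) :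
    Measurable (S.indicator fun _ => (1 : ℂ)) :=
  measurable_const.indicator hS

/-- Operators of the bounded functional calculus commute with the spectral projections. -/
lemma ProjectionValuedMeasure.IsIntegral.proj_comm {f : ℝ → ℂ} {T : H →L[ℂ] H} (hT : E.IsIntegral f T)
    (hf : Measurable f) {C : ℝ} (hC : ∀ l, ‖f l‖ ≤ C) {S : Set ℝ} (hS : MeasurableSet S) (x : H) :
    E.proj S (T x) = T (E.proj S x) := by
  have h₁ := (isIntegral_proj hS).mul hT (measurable_indicator_one hS) hf
    (norm_indicator_one_le S) hC
  have h₂ := hT.mul (isIntegral_proj hS) hf (measurable_indicator_one hS) hC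
    (norm_indicator_one_le S)
  simp only [mul_comm] at h₁ h₂
  exact DFunLike.congr_fun (h₁.unique h₂) x

lemma IsSpectralMeasure.proj_mem_domain (hE : IsSpectralMeasure D E) (Λ : ℝ) (x : H) :
    E.proj (Set.Icc (-Λ) Λ) x ∈ D.domain := by
  rw [hE.1, E.scalarMeasure_proj measurableSet_Icc]
  have h : ∫⁻ l in Set.Icc (-Λ) Λ, ENNReal.ofReal (l ^ 2) ∂(E.scalarMeasure x) ≤
      ∫⁻ _ in Set.Icc (-Λ) Λ, ENNReal.ofReal (Λ ^ 2) ∂(E.scalarMeasure x) :=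
    setLIntegral_mono measurable_const fun l hl =>
      ENNReal.ofReal_le_ofReal (sq_le_sq' hl.1 hl.2)
  refine h.trans_lt ?_
  rw [setLIntegral_const]
  exact ENNReal.mul_lt_top ENNReal.ofReal_lt_top (measure_lt_top _ _)

/-- A vector killed by all the projections `E([-n, n])` vanishes. -/
lemma eq_zero_of_proj_Icc_eq_zero {y : H} {N : ℕ}
    (h : ∀ n : ℕ, N ≤ n → E.proj (Set.Icc (-n : ℝ) n) y = 0) : y = 0 := by
  have hU : (⋃ n : ℕ, Set.Icc (-((n + N : ℕ) : ℝ)) ((n + N : ℕ) : ℝ)) = Set.univ := by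
    refine Set.eq_univ_of_forall fun l => Set.mem_iUnion.2 ?_
    obtain ⟨n, hn⟩ := exists_nat_ge |l|
    refine ⟨n, abs_le.1 (hn.trans ?_)⟩
    exact_mod_cast Nat.le_add_right n N
  have h₀ : E.scalarMeasure y Set.univ = 0 := by
    rw [← hU]
    refine measure_iUnion_null fun n => ?_
    rw [E.scalarMeasure_apply measurableSet_Icc, h _ (Nat.le_add_left N n)]
    simp
  rw [E.scalarMeasure_univ, ENNReal.ofReal_eq_zero] at h₀
  simpa using le_antisymm h₀ (sq_nonneg _)

lemma IsSpectralMeasure.proj_apply_proj (hE : IsSpectralMeasure D E) {Λ : ℝ} {T : H →L[ℂ] H}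
    (hT : E.IsIntegral (cutoff Λ) T) (x : H) :
    E.proj (Set.Icc (-Λ) Λ) (D ⟨_, hE.proj_mem_domain Λ x⟩) = T x := by
  let S : H →ₗ[ℂ] H := (E.proj (Set.Icc (-Λ) Λ) : H →ₗ[ℂ] H) ∘ₗ D.toFun ∘ₗ
    (E.proj (Set.Icc (-Λ) Λ) : H →ₗ[ℂ] H).codRestrict D.domain (hE.proj_mem_domain Λ)
  suffices h : S = T from DFunLike.congr_fun h x
  refine (ext_inner_map _ _).1 fun y => ?_
  have h₁ : ⟪y, S y⟫_ℂ = ⟪y, T y⟫_ℂ := by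
    have h₂ : ⟪y, S y⟫_ℂ =
        ⟪E.proj (Set.Icc (-Λ) Λ) y, D ⟨_, hE.proj_mem_domain Λ y⟩⟫_ℂ :=
      E.inner_proj_right measurableSet_Icc _ _
    rw [h₂, hT y, hE.2 ⟨_, hE.proj_mem_domain Λ y⟩, E.scalarMeasure_proj measurableSet_Icc,
      cutoff, integral_indicator measurableSet_Icc]
  have h₃ := congrArg (starRingEnd ℂ) h₁
  rwa [inner_conj_symm, inner_conj_symm] at h₃

/-- On the range of `E([-Λ, Λ])` the operator `D` is the bounded operator `∫ l 1_{[-Λ, Λ]} dE`.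
The diagonal of `D` only shows this after compression by `E([-n, n])`, for every `n ≥ Λ`; these
projections exhaust the space. -/
lemma IsSpectralMeasure.apply_proj (hE : IsSpectralMeasure D E) {Λ : ℝ} {T : H →L[ℂ] H}
    (hT : E.IsIntegral (cutoff Λ) T) (x : H) :
    D ⟨_, hE.proj_mem_domain Λ x⟩ = T x := by
  obtain ⟨N, hN⟩ := exists_nat_ge |Λ|
  refine sub_eq_zero.1 (eq_zero_of_proj_Icc_eq_zero (E := E) (N := N) fun n hn => ?_)
  have hΛn : Λ ≤ n := (le_abs_self Λ).trans (hN.trans (by exact_mod_cast hn))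
  have hsub : Set.Icc (-Λ) Λ ⊆ Set.Icc (-n : ℝ) n := Set.Icc_subset_Icc (neg_le_neg hΛn) hΛn
  have hTn := isIntegral_integral (E := E) (measurable_cutoff n) (norm_cutoff_le n)
  have hPP : E.proj (Set.Icc (-n : ℝ) n) (E.proj (Set.Icc (-Λ) Λ) x) =
      E.proj (Set.Icc (-Λ) Λ) x := by
    rw [E.proj_proj measurableSet_Icc measurableSet_Icc, Set.inter_eq_right.2 hsub]
  have h₁ := hE.proj_apply_proj hTn (E.proj (Set.Icc (-Λ) Λ) x)
  simp only [hPP] at h₁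
  have h₂ : E.integral (cutoff n) * E.proj (Set.Icc (-Λ) Λ) = T := by
    refine IsIntegral.unique (hTn.mul (isIntegral_proj measurableSet_Icc) (measurable_cutoff n)
      (measurable_indicator_one measurableSet_Icc) (norm_cutoff_le n)
      (norm_indicator_one_le _)) ?_
    convert hT using 2 with l
    by_cases hl : l ∈ Set.Icc (-Λ) Λ
    · simp [cutoff, hl, hsub hl]
    · simp [cutoff, hl]
  have h₃ : E.proj (Set.Icc (-n : ℝ) n) * T = T := by
    refine IsIntegral.unique ((isIntegral_proj measurableSet_Icc).mul hT
      (measurable_indicator_one measurableSet_Icc) (measurable_cutoff Λ)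
      (norm_indicator_one_le _) (norm_cutoff_le Λ)) ?_
    convert hT using 2 with l
    by_cases hl : l ∈ Set.Icc (-Λ) Λ
    · simp [cutoff, hl, hsub hl]
    · simp [cutoff, hl]
  have h₄ : E.proj (Set.Icc (-n : ℝ) n) (T x) = T x := DFunLike.congr_fun h₃ x
  rw [map_sub, h₁, h₄, ← DFunLike.congr_fun h₂ x]
  exact sub_self _

/-- The spectral projection commutes with `D` on the domain of `D`. -/
lemma IsSpectralMeasure.proj_apply (hE : IsSpectralMeasure D E) (hD : IsSelfAdjoint D)
    (hdense : Dense (D.domain : Set H)) {Λ : ℝ} {T : H →L[ℂ] H}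
    (hT : E.IsIntegral (cutoff Λ) T) (y : D.domain) :
    E.proj (Set.Icc (-Λ) Λ) (D y) = T y := by
  refine ext_inner_left ℂ fun z => ?_
  have hsymm := LinearPMap.adjoint_isFormalAdjoint hdense
  rw [LinearPMap.isSelfAdjoint_def.1 hD] at hsymm
  rw [E.inner_proj_right measurableSet_Icc, ← hsymm ⟨_, hE.proj_mem_domain Λ z⟩ y,
    hE.apply_proj hT, ← ContinuousLinearMap.adjoint_inner_right,
    hT.adjoint_eq (conj_cutoff Λ)]

/-! ### The unitary group on a bounded spectral subspace -/

lemma norm_exp_I_mul (t l : ℝ) : ‖Complex.exp (Complex.I * t * l)‖ = 1 := by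
  rw [show Complex.I * t * l = ((t * l : ℝ) : ℂ) * Complex.I by push_cast; ring]
  exact Complex.norm_exp_ofReal_mul_I _

lemma measurable_exp_I_mul (t : ℝ) : Measurable fun l : ℝ => Complex.exp (Complex.I * t * l) := by
  fun_prop

/-- `∫ e^{itl} dE(l)` is isometric. -/
lemma ProjectionValuedMeasure.IsIntegral.norm_exp_apply {t : ℝ} {U : H →L[ℂ] H}
    (hU : E.IsIntegral (fun l => Complex.exp (Complex.I * t * l)) U) (x : H) : ‖U x‖ = ‖x‖ := by
  have h₁ : ContinuousLinearMap.adjoint U * U = 1 := by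
    refine IsIntegral.unique (hU.adjoint_mul_self (measurable_exp_I_mul t)
      (fun l => (norm_exp_I_mul t l).le)) ?_
    convert isIntegral_one (E := E) using 2 with l
    rw [RCLike.conj_mul, norm_exp_I_mul]
    simp
  have h₂ : ⟪U x, U x⟫_ℂ = ⟪x, x⟫_ℂ := by
    rw [← ContinuousLinearMap.adjoint_inner_right]
    exact congrArg _ (DFunLike.congr_fun h₁ x)
  rw [inner_self_eq_norm_sq_to_K, inner_self_eq_norm_sq_to_K] at h₂
  exact (sq_eq_sq₀ (norm_nonneg _) (norm_nonneg _)).1 (by exact_mod_cast h₂)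

/-- On the range of `E([-Λ, Λ])`, the group `e^{itD}` is differentiable in norm with derivative
`i D e^{itD}`. -/
lemma hasDerivAt_exp_apply {Λ : ℝ} {T : H →L[ℂ] H} (hT : E.IsIntegral (cutoff Λ) T)
    {U : ℝ → H →L[ℂ] H}
    (hU : ∀ t : ℝ, E.IsIntegral (fun l => Complex.exp (Complex.I * t * l)) (U t)) {x : H}
    (hx : E.proj (Set.Icc (-Λ) Λ) x = x) (t : ℝ) :
    HasDerivAt (fun s => U s x) (Complex.I • T (U t x)) t := by
  set S := Set.Icc (-Λ) Λ
  have hS : MeasurableSet S := measurableSet_Icc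
  rw [hasDerivAt_iff_isLittleO_nhds_zero]
  have hO : (fun h : ℝ => U (t + h) x - U t x - h • (Complex.I • T (U t x))) =O[𝓝 0]
      fun h : ℝ => h ^ 2 := by
    refine Asymptotics.IsBigO.of_bound (|Λ| ^ 2 * ‖x‖) ?_
    have hsmall : ∀ᶠ h : ℝ in 𝓝 0, |h| * |Λ| ≤ 1 := by
      have : Tendsto (fun h : ℝ => |h| * |Λ|) (𝓝 0) (𝓝 (|0| * |Λ|)) :=
        (continuous_abs.mul continuous_const).tendsto 0
      rw [abs_zero, zero_mul] at this
      exact this.eventually_le_const one_pos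
    filter_upwards [hsmall] with h hh
    -- the remainder is the integral of `e^{itl} (e^{ihl} - 1 - ihl)`, cut off to `[-Λ, Λ]`
    have hm := measurable_indicator_one hS
    have hb := norm_indicator_one_le S
    have hTU := hT.mul (hU t) (measurable_cutoff Λ) (measurable_exp_I_mul t) (norm_cutoff_le Λ)
      (fun l => (norm_exp_I_mul t l).le)
    have hTUb : ∀ l, ‖cutoff Λ l * Complex.exp (Complex.I * t * l)‖ ≤ |Λ| := fun l => by
      rw [norm_mul, norm_exp_I_mul, mul_one]; exact norm_cutoff_le Λ l
    have hTUm := (measurable_cutoff Λ).mul (measurable_exp_I_mul t)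
    have hi : ∀ s : ℝ, ∀ y, Integrable (fun l : ℝ => Complex.exp (Complex.I * s * l))
        (E.scalarMeasure y) := fun s =>
      integrable_of_bounded (measurable_exp_I_mul s) (fun l => (norm_exp_I_mul s l).le)
    have hR := ((hU (t + h)).sub (hU t) (hi _) (hi _)).sub (hTU.const_smul (h * Complex.I))
      (fun y => (hi _ y).sub (hi _ y))
      (fun y => (integrable_of_bounded hTUm hTUb y).const_mul _)
    have hRm : Measurable fun l : ℝ => Complex.exp (Complex.I * (t + h : ℝ) * l) -
        Complex.exp (Complex.I * t * l) -
          h * Complex.I * (cutoff Λ l * Complex.exp (Complex.I * t * l)) :=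
      ((measurable_exp_I_mul _).sub (measurable_exp_I_mul _)).sub (hTUm.const_mul _)
    have hRb : ∀ l : ℝ, ‖Complex.exp (Complex.I * (t + h : ℝ) * l) -
        Complex.exp (Complex.I * t * l) -
          h * Complex.I * (cutoff Λ l * Complex.exp (Complex.I * t * l))‖ ≤
            1 + 1 + |h| * |Λ| := fun l => by
      refine (norm_sub_le _ _).trans (add_le_add ((norm_sub_le _ _).trans
        (add_le_add (norm_exp_I_mul _ l).le (norm_exp_I_mul t l).le)) ?_)
      rw [norm_mul, norm_mul, Complex.norm_real, Complex.norm_I, mul_one]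
      exact mul_le_mul_of_nonneg_left (hTUb l) (norm_nonneg _)
    have hRP := hR.mul (isIntegral_proj hS) hRm hm hRb hb
    have hnorm := hRP.norm_le (C := (|h| * |Λ|) ^ 2) (hRm.mul hm) fun l => by
      by_cases hl : l ∈ S
      · have hle : ‖Complex.I * h * l‖ ≤ |h| * |Λ| := by
          rw [norm_mul, norm_mul, Complex.norm_I, one_mul, Complex.norm_real, Complex.norm_real]
          exact mul_le_mul_of_nonneg_left ((abs_le.2 hl).trans (le_abs_self Λ)) (abs_nonneg h)
        have hfac : Complex.exp (Complex.I * (t + h : ℝ) * l) - Complex.exp (Complex.I * t * l) -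
            h * Complex.I * (cutoff Λ l * Complex.exp (Complex.I * t * l)) =
            Complex.exp (Complex.I * t * l) *
              (Complex.exp (Complex.I * h * l) - 1 - Complex.I * h * l) := by
          rw [cutoff, Set.indicator_of_mem hl,
            show Complex.I * (t + h : ℝ) * l = Complex.I * t * l + Complex.I * h * l by
              push_cast; ring, Complex.exp_add]
          ring
        rw [Set.indicator_of_mem hl, mul_one, hfac, norm_mul, norm_exp_I_mul, one_mul]
        exact (Complex.norm_exp_sub_one_sub_id_le (hle.trans hh)).trans
          (pow_le_pow_left₀ (norm_nonneg _) hle 2)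
      · rw [Set.indicator_of_notMem hl, mul_zero, norm_zero]
        positivity
    have hval : U (t + h) x - U t x - h • (Complex.I • T (U t x)) =
        ((U (t + h) - U t - (h * Complex.I : ℂ) • (T * U t)) * E.proj S) x := by
      rw [mul_apply_eq_comp, hx]
      simp [mul_smul]
    rw [hval]
    refine (ContinuousLinearMap.le_of_opNorm_le _ hnorm x).trans_eq ?_
    rw [norm_pow, Real.norm_eq_abs]
    ring
  exact hO.trans_isLittleO (by simpa using Asymptotics.isLittleO_pow_id (𝕜 := ℝ) one_lt_two)

/-! ### Lipschitz seminorms -/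

omit [CompleteSpace H] in
/-- The infimum that defines `lipSeminorm` is attained, as far as the bound `1` is concerned. -/
lemma norm_commutator_le_of_lipSeminorm_le_one {T : H →ₗ.[ℂ] H} {a : H →L[ℂ] H}
    (h : lipSeminorm T a ≤ 1) :
    ∃ hd : ∀ x : T.domain, a (x : H) ∈ T.domain,
      ∀ x : T.domain, ‖T ⟨a x, hd x⟩ - a (T x)‖ ≤ ‖(x : H)‖ := by
  have key : ∀ ε : ℝ, 0 < ε → ∃ hd : ∀ x : T.domain, a (x : H) ∈ T.domain,
      ∀ x : T.domain, ‖T ⟨a x, hd x⟩ - a (T x)‖ ≤ (1 + ε) * ‖(x : H)‖ := fun ε hε => by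
    have hlt : lipSeminorm T a < ENNReal.ofReal (1 + ε) :=
      h.trans_lt (by rw [ENNReal.one_lt_ofReal]; linarith)
    obtain ⟨C, hC⟩ := iInf_lt_iff.1 hlt
    obtain ⟨⟨hd, hb⟩, hC⟩ := iInf_lt_iff.1 hC
    refine ⟨hd, fun x => (hb x).trans (mul_le_mul_of_nonneg_right ?_ (norm_nonneg _))⟩
    rw [← ENNReal.ofReal_coe_nnreal, ENNReal.ofReal_lt_ofReal_iff (by linarith)] at hC
    exact hC.le
  obtain ⟨hd, -⟩ := key 1 one_pos
  refine ⟨hd, fun x => ?_⟩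
  have hlim : Tendsto (fun ε : ℝ => (1 + ε) * ‖(x : H)‖) (𝓝[>] 0) (𝓝 ((1 + 0) * ‖(x : H)‖)) :=
    ((continuous_const.add continuous_id).mul continuous_const).continuousWithinAt
  rw [add_zero, one_mul] at hlim
  refine ge_of_tendsto hlim ?_
  filter_upwards [self_mem_nhdsWithin] with ε hε
  exact (key ε hε).2 x

/-- Compression to a spectral subspace does not increase the Lipschitz seminorm, because
`[P D P, P a P] = P [D, a] P` when `P` commutes with `D`. -/
lemma IsSpectralMeasure.lipSeminorm_compression_le (hE : IsSpectralMeasure D E)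
    (hD : IsSelfAdjoint D) (hdense : Dense (D.domain : Set H)) (Λ : ℝ) (a : H →L[ℂ] H) :
    lipSeminorm (truncatedOperator D (E.proj (Set.Icc (-Λ) Λ)))
      (compression (E.proj (Set.Icc (-Λ) Λ)) a) ≤ lipSeminorm D a := by
  have hT := isIntegral_integral (E := E) (measurable_cutoff Λ) (norm_cutoff_le Λ)
  refine le_iInf₂ fun C hC => ?_
  obtain ⟨hd, hb⟩ := hC
  refine iInf₂_le C ⟨fun _ => hE.proj_mem_domain Λ _, fun x => ?_⟩
  have hPP : ∀ y, E.proj (Set.Icc (-Λ) Λ) (E.proj (Set.Icc (-Λ) Λ) y) =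
      E.proj (Set.Icc (-Λ) Λ) y := fun y => by
    rw [E.proj_proj measurableSet_Icc measurableSet_Icc, Set.inter_self]
  set y : D.domain := ⟨_, hE.proj_mem_domain Λ (x : H)⟩
  have hy : (y : H) = E.proj (Set.Icc (-Λ) Λ) (x : H) := rfl
  have hPD : E.proj (Set.Icc (-Λ) Λ) (D y) = D y := by
    rw [hE.proj_apply hD hdense hT, hy, ← hE.apply_proj hT (E.proj _ (x : H))]
    simp only [hPP]
    rfl
  have h₁ : truncatedOperator D (E.proj (Set.Icc (-Λ) Λ))
      ⟨compression (E.proj (Set.Icc (-Λ) Λ)) a x, hE.proj_mem_domain Λ _⟩ =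
        E.proj (Set.Icc (-Λ) Λ) (D ⟨a y, hd y⟩) := by
    have h₂ : truncatedOperator D (E.proj (Set.Icc (-Λ) Λ))
      ⟨compression (E.proj (Set.Icc (-Λ) Λ)) a x, hE.proj_mem_domain Λ _⟩ =
        E.proj (Set.Icc (-Λ) Λ) (D ⟨_, hE.proj_mem_domain Λ
          (E.proj (Set.Icc (-Λ) Λ) (a y))⟩) := rfl
    rw [h₂, hE.proj_apply_proj hT, hE.proj_apply hD hdense hT,
      ← hE.apply_proj hT, ← hE.apply_proj hT]
    simp only [hPP]
  have h₃ : compression (E.proj (Set.Icc (-Λ) Λ)) a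
      (truncatedOperator D (E.proj (Set.Icc (-Λ) Λ)) x) =
        E.proj (Set.Icc (-Λ) Λ) (a (D y)) := by
    have h₄ : compression (E.proj (Set.Icc (-Λ) Λ)) a
      (truncatedOperator D (E.proj (Set.Icc (-Λ) Λ)) x) =
        E.proj (Set.Icc (-Λ) Λ) (a (E.proj (Set.Icc (-Λ) Λ)
          (E.proj (Set.Icc (-Λ) Λ) (D y)))) := rfl
    rw [h₄, hPD, hPD]
  have hP1 : ∀ z, ‖E.proj (Set.Icc (-Λ) Λ) z‖ ≤ ‖z‖ := fun z => by
    simpa using ContinuousLinearMap.le_of_opNorm_le _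
      ((isIntegral_proj (E := E) measurableSet_Icc).norm_le
        (measurable_indicator_one measurableSet_Icc) (norm_indicator_one_le _)) z
  rw [h₁, h₃, ← map_sub]
  exact (hP1 _).trans ((hb y).trans (mul_le_mul_of_nonneg_left (hP1 _) C.coe_nonneg))

/-- An operator that is `1`-Lipschitz for `T = P D P` changes by at most `|t - s|` along the orbit
of a vector in the range of `P`: the derivative of `⟨ψ_t, a ψ_t⟩` is `-i ⟨ψ_t, [T, a] ψ_t⟩`. -/
lemma IsSpectralMeasure.re_inner_orbit_sub_le (hE : IsSpectralMeasure D E) {Λ : ℝ}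
    {U : ℝ → H →L[ℂ] H}
    (hU : ∀ t : ℝ, E.IsIntegral (fun l => Complex.exp (Complex.I * t * l)) (U t)) {x : H}
    (hx : E.proj (Set.Icc (-Λ) Λ) x = x) (hx1 : ‖x‖ = 1) {a : H →L[ℂ] H}
    (ha : lipSeminorm (truncatedOperator D (E.proj (Set.Icc (-Λ) Λ))) a ≤ 1) (s t : ℝ) :
    (⟪U s x, a (U s x)⟫_ℂ).re - (⟪U t x, a (U t x)⟫_ℂ).re ≤ |s - t| := by
  have hT := isIntegral_integral (E := E) (measurable_cutoff Λ) (norm_cutoff_le Λ)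
  set T := E.integral (cutoff Λ)
  obtain ⟨hd, hb⟩ := norm_commutator_le_of_lipSeminorm_le_one ha
  have hcomm : ∀ y, ‖T (a y) - a (T y)‖ ≤ ‖y‖ := fun y => by
    have hy : y ∈ (truncatedOperator D (E.proj (Set.Icc (-Λ) Λ))).domain :=
      hE.proj_mem_domain Λ y
    have htr : ∀ (z : H) hz, truncatedOperator D (E.proj (Set.Icc (-Λ) Λ)) ⟨z, hz⟩ = T z :=
      fun z _ => hE.proj_apply_proj hT z
    have h := hb ⟨y, hy⟩
    rwa [htr, htr] at h
  have hderiv : ∀ r : ℝ, HasDerivAt (fun r => ⟪U r x, a (U r x)⟫_ℂ)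
      (-Complex.I * ⟪U r x, T (a (U r x)) - a (T (U r x))⟫_ℂ) r := fun r => by
    have h := hasDerivAt_exp_apply hT hU hx r
    have ha' := ((a.restrictScalars ℝ).hasFDerivAt.comp_hasDerivAt r h)
    refine HasDerivAt.congr_deriv (f := fun r => ⟪U r x, a (U r x)⟫_ℂ) (h.inner ℂ ha') ?_
    have hsa : ⟪T (U r x), a (U r x)⟫_ℂ = ⟪U r x, T (a (U r x))⟫_ℂ := by
      rw [← ContinuousLinearMap.adjoint_inner_right, hT.adjoint_eq (conj_cutoff Λ)]
    simp only [ContinuousLinearMap.coe_restrictScalars', map_smul, inner_smul_left,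
      inner_smul_right, inner_sub_right, hsa, Complex.conj_I]
    ring
  have hbound : ∀ r : ℝ, ‖-Complex.I * ⟪U r x, T (a (U r x)) - a (T (U r x))⟫_ℂ‖ ≤ 1 :=
    fun r => by
      have hn : ‖U r x‖ = 1 := ((hU r).norm_exp_apply x).trans hx1
      rw [norm_mul, norm_neg, Complex.norm_I, one_mul]
      refine (norm_inner_le_norm _ _).trans ?_
      rw [hn, one_mul]
      exact (hcomm _).trans hn.le
  have h := Convex.norm_image_sub_le_of_norm_hasDerivWithin_le (s := Set.univ) (x := t) (y := s)
    (fun r _ => (hderiv r).hasDerivWithinAt) (fun r _ => hbound r) convex_univ trivial trivial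
  rw [one_mul, Real.norm_eq_abs] at h
  rw [← Complex.sub_re]
  exact (Complex.re_le_norm _).trans h

/-! ### The orbit of a vector state -/

/-- A nonzero spectral projection comes from a spectral measure, which then also defines the
unitary group. -/
lemma exists_isSpectralMeasure {D : H →ₗ.[ℂ] H} {S : Set ℝ} (hS : spectralProjection D S ≠ 0) :
    ∃ E : ProjectionValuedMeasure H, IsSpectralMeasure D E ∧
      (∀ S, spectralProjection D S = E.proj S) ∧
      ∀ t : ℝ, E.IsIntegral (fun l => Complex.exp (Complex.I * t * l)) (unitaryGroup D t) := by
  by_cases h : ∃ E : ProjectionValuedMeasure H, IsSpectralMeasure D E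
  · refine ⟨h.choose, h.choose_spec, fun S => dif_pos h, fun t => ?_⟩
    rw [unitaryGroup, dif_pos h]
    exact isIntegral_integral (measurable_exp_I_mul t) fun l => (norm_exp_I_mul t l).le
  · exact absurd (dif_neg h) hS

omit [CompleteSpace H] in
lemma lipDist_le {V : Submodule ℝ (H →L[ℂ] H)} {T : H →ₗ.[ℂ] H} {φ χ : V →ₗ[ℝ] ℝ} {r : ℝ}
    (h : ∀ a : V, lipSeminorm T (a : H →L[ℂ] H) ≤ 1 → φ a - χ a ≤ r) :
    lipDist V T φ χ ≤ ENNReal.ofReal r :=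
  iSup₂_le fun a ha => ENNReal.ofReal_le_ofReal (h a ha)

omit [CompleteSpace H] in
lemma vectorFunctional_nonneg {V : Submodule ℝ (H →L[ℂ] H)} (ψ : H) (a : V)
    (ha : 0 ≤ (a : H →L[ℂ] H)) : 0 ≤ vectorFunctional V ψ a :=
  ((ContinuousLinearMap.nonneg_iff_isPositive _).1 ha).re_inner_nonneg_right ψ

variable [TopologicalSpace.SeparableSpace H] {X : SpectralTriple H}

lemma SpectralTriple.sharp_orbit {Λ : ℝ} {ψ : H} {t : ℝ} (hP : IsStarProjection (X.P Λ))
    (h : X.P Λ (unitaryGroup X.D t ψ) = unitaryGroup X.D t ψ) :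
    X.sharp Λ (X.orbit Λ ψ t) = vectorFunctional X.unitizedSa (unitaryGroup X.D t ψ) := by
  refine LinearMap.ext fun a => congrArg Complex.re ?_
  change ⟪unitaryGroup X.D t ψ, X.P Λ ((a : H →L[ℂ] H) (X.P Λ (unitaryGroup X.D t ψ)))⟫_ℂ = _
  rw [← ContinuousLinearMap.adjoint_inner_left, hP.isSelfAdjoint.adjoint_eq, h]

end SpectralTruncation

theorem mainTheorem9 {H : Type*} [NormedAddCommGroup H] [InnerProductSpace ℂ H] [CompleteSpace H]
    [TopologicalSpace.SeparableSpace H] (X : SpectralTruncation.SpectralTriple H) (Λ : ℝ)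
    (ψ : H) (hψ : ψ ∈ LinearMap.range (X.P Λ : H →ₗ[ℂ] H)) (hψ_norm : ‖ψ‖ = 1) :
    (∀ t : ℝ,
      SpectralTruncation.IsState (X.O Λ) (X.orderUnit Λ) (X.orbit Λ ψ t) ∧
      SpectralTruncation.IsState X.unitizedSa X.one (X.sharp Λ (X.orbit Λ ψ t)) ∧
      X.sharp Λ (X.orbit Λ ψ t) =
        SpectralTruncation.vectorFunctional X.unitizedSa
          (SpectralTruncation.unitaryGroup X.D t ψ)) ∧
    ∀ t₁ t₂ : ℝ,
      X.dist (X.truncD Λ) (X.sharp Λ (X.orbit Λ ψ t₁)) (X.sharp Λ (X.orbit Λ ψ t₂))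
        ≤ ENNReal.ofReal |t₁ - t₂| ∧
      X.distFlat Λ (X.orbit Λ ψ t₁) (X.orbit Λ ψ t₂)
        ≤ X.distTrunc Λ (X.orbit Λ ψ t₁) (X.orbit Λ ψ t₂) ∧
      X.distTrunc Λ (X.orbit Λ ψ t₁) (X.orbit Λ ψ t₂) ≤ ENNReal.ofReal |t₁ - t₂| := by
  have hPψ : SpectralTruncation.spectralProjection X.D (Set.Icc (-Λ) Λ) ≠ 0 := fun h => by
    obtain ⟨y, rfl⟩ := hψ
    have h₀ : X.P Λ y = 0 := DFunLike.congr_fun h y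
    exact one_ne_zero (hψ_norm.symm.trans ((congrArg norm h₀).trans norm_zero))
  obtain ⟨E, hE, hEP, hU⟩ := SpectralTruncation.exists_isSpectralMeasure hPψ
  have hP : X.P Λ = E.proj (Set.Icc (-Λ) Λ) := hEP _
  have htrunc : X.truncD Λ =
      SpectralTruncation.truncatedOperator X.D (E.proj (Set.Icc (-Λ) Λ)) :=
    congrArg _ hP
  have hstar : IsStarProjection (X.P Λ) := hP ▸ E.isStarProjection _ measurableSet_Icc
  have hψP : E.proj (Set.Icc (-Λ) Λ) ψ = ψ := by
    obtain ⟨y, rfl⟩ := hψ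
    rw [← hP]
    exact DFunLike.congr_fun hstar.isIdempotentElem y
  have hfix : ∀ t, X.P Λ (SpectralTruncation.unitaryGroup X.D t ψ) =
      SpectralTruncation.unitaryGroup X.D t ψ := fun t => by
    rw [hP, (hU t).proj_comm (SpectralTruncation.measurable_exp_I_mul t)
      (fun l => (SpectralTruncation.norm_exp_I_mul t l).le) measurableSet_Icc, hψP]
  have hsharp := fun t => SpectralTruncation.SpectralTriple.sharp_orbit hstar (hfix t)
  have hone : ∀ t, X.sharp Λ (X.orbit Λ ψ t) X.one = 1 := fun t => by
    rw [hsharp]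
    change (⟪SpectralTruncation.unitaryGroup X.D t ψ,
      SpectralTruncation.unitaryGroup X.D t ψ⟫_ℂ).re = 1
    rw [inner_self_eq_norm_sq_to_K, (hU t).norm_exp_apply, hψ_norm]
    simp
  refine ⟨fun t => ⟨⟨SpectralTruncation.vectorFunctional_nonneg _, hone t⟩, ⟨?_, hone t⟩,
    hsharp t⟩, fun t₁ t₂ => ⟨?_, ?_, ?_⟩⟩
  · rw [hsharp]
    exact SpectralTruncation.vectorFunctional_nonneg _
  · rw [hsharp, hsharp]
    refine SpectralTruncation.lipDist_le fun a ha => ?_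
    rw [htrunc] at ha
    exact hE.re_inner_orbit_sub_le hU hψP hψ_norm ha t₁ t₂
  · -- every competitor `a` for `d^♭` yields the competitor `P a P` for `d_{O_Λ, D_Λ}`
    refine iSup₂_le fun a ha => ?_
    have hle : SpectralTruncation.lipSeminorm (X.truncD Λ)
        (SpectralTruncation.compression (X.P Λ) (a : H →L[ℂ] H)) ≤ 1 := by
      rw [htrunc, hP]
      exact (hE.lipSeminorm_compression_le X.isSelfAdjoint X.dense_domain Λ _).trans ha
    exact le_iSup₂_of_le (X.π Λ (Submodule.inclusion le_sup_left a)) hle le_rfl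
  · refine SpectralTruncation.lipDist_le fun b hb => ?_
    rw [htrunc] at hb
    exact hE.re_inner_orbit_sub_le hU hψP hψ_norm hb t₁ t₂
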